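/- Let $G$ be a finite group and let $\mathcal{S}et^G$ be the category of finite $G$-sets and equivariant maps. For a map $g\colon S\to T$ of finite $G$-sets, let the dependent product $\Pi_g\colon \mathcal{S}et^G_{/S}\to \mathcal{S}et^G_{/T}$ be the right adjoint of the pullback functor $g^*\colon \mathcal{S}et^G_{/T}\to \mathcal{S}et^G_{/S}$. The category of polynomials $\mathcal{P}^G$ has the finite $G$-sets as objects, and a morphism $S\to T$ is an isomorphism class of polynomials (bispans) $S\xleftarrow{f}U_1\xrightarrow{g}U_2\xrightarrow{h}T$, where an isomorphism of polynomials is a pair of isomorphisms $U_1\cong U_1'$, $U_2\cong U_2'$ compatible with all the maps; $g$ is called the norm map and $h$ the transfer map. The composite of $S\xleftarrow{f}A\xrightarrow{g}B\xrightarrow{h}T$ followed by $T\xleftarrow{r}C\xrightarrow{q}D\xrightarrow{t}U$ is represented by $$S\leftarrow A\times_B (E\times_D C)\to E\to U,$$ where $E=\Pi_q(C\times_T B\to C)$, the map $E\times_D C\to B$ is the counit $E\times_D C\to C\times_T B$ of the adjunction $q^*\dashv\Pi_q$ followed by the projection to $B$, the first map is the projection to $A$ followed by $f$, the second is the projection to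 $E$, and the third is $E\to D$ followed by $t$. The identity of $S$ is represented by $S=S=S=S$. An indexing category is a wide, pullback stable, finite coproduct complete subcategory $\mathcal{O}$ of $\mathcal{S}et^G$ (that is, $\mathcal{O}$ has finite coproducts and the inclusion into $\mathcal{S}et^G$ preserves them). A pair $(\mathcal{O}_a,\mathcal{O}_m)$ of indexing categories is compatible if for every map $g\colon S\to T$ in $\mathcal{O}_m$ and every map $X\to S$ in $\mathcal{O}_a$, the map $\Pi_g(X)\to T$ is in $\mathcal{O}_a$. Let $\mathcal{P}^G_{\mathcal{O}_a,\mathcal{O}_m}$ be the wide subgraph of $\mathcal{P}^G$ whose arrows are the isomorphism classes containing a polynomial $S\leftarrow U_1\xrightarrow{g}U_2\xrightarrow{h}T$ with $g\in\mathcal{O}_m$ and $h\in\mathcal{O}_a$. **Theorem.** If $(\mathcal{O}_a,\mathcal{O}_m)$ is a compatible pair of indexing categories, then $\mathcal{P}^G_{\mathcal{O}_a,\mathcal{O}_m}$ is a subcategory of $\mathcal{P}^G$: it contains all identities and is closed under composition. Moreover, the class of a polynomial $S\leftarrow U_1\xrightarrow{g}U_2\xrightarrow{h}T$ lies in $\mathcal{P}^G_{\mathcal{O}_a,\mathcal{O}_m}$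 if and only if $g\in\mathcal{O}_m$ and $h\in\mathcal{O}_a$. -/

import Mathlib

open CategoryTheory Limits
universe u v

/-- The category of finite `G`-sets and equivariant maps. -/
abbrev FinGSet (G : Type v) [Group G] := Action FintypeCat.{u} G

namespace FinGSet

section Elements

variable {G : Type v} [Group G]

lemma act_map {X Y : FinGSet.{u} G} (f : X ⟶ Y) (a : G) (x : X.V) :
    f (a • x : X.V) = (a • f x : Y.V) :=
  ConcreteCategory.congr_hom (f.comm a) x

lemma hom_ext_apply {X Y : FinGSet.{u} G} {f f' : X ⟶ Y}
    (h : ∀ x : X.V, f x = f' x) : f = f' :=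
  ConcreteCategory.hom_ext _ _ h

lemma comp_app {X Y Z : FinGSet.{u} G} (f : X ⟶ Y) (g : Y ⟶ Z) (x : X.V) :
    (f ≫ g) x = g (f x) := rfl

/-- The finite `G`-set on a finite type with a `G`-action. -/
def ofAct (α : Type u) [Finite α] [MulAction G α] : FinGSet.{u} G :=
  letI : MulAction G (FintypeCat.of α) := inferInstanceAs (MulAction G α)
  Action.FintypeCat.ofMulAction G (FintypeCat.of α)

/-- An equivariant function as a morphism of finite `G`-sets. -/
def mkHom {X Y : FinGSet.{u} G} (f : X.V → Y.V)
    (hf : ∀ (a : G) (x : X.V), f (a • x : X.V) = (a • f x : Y.V)) : X ⟶ Y where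
  hom := FintypeCat.homMk f
  comm a := by
    apply ConcreteCategory.hom_ext
    intro x
    exact hf a x

@[simp] lemma mkHom_apply {X Y : FinGSet.{u} G} (f : X.V → Y.V)
    (hf : ∀ (a : G) (x : X.V), f (a • x : X.V) = (a • f x : Y.V)) (x : X.V) :
    mkHom f hf x = f x := rfl

/-- An equivariant one-to-one correspondence is the graph of an isomorphism. -/
lemma exists_iso {X Y : FinGSet.{u} G} (r : X.V → Y.V → Prop)
    (hr : ∀ (a : G) (x : X.V) (y : Y.V), r x y → r (a • x : X.V) (a • y : Y.V))
    (h₁ : ∀ x, ∃ y, r x y) (h₂ : ∀ y, ∃ x, r x y)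
    (h₃ : ∀ x y y', r x y → r x y' → y = y') (h₄ : ∀ x x' y, r x y → r x' y → x = x') :
    ∃ e : X ≅ Y, ∀ x : X.V, r x (e.hom x) := by
  choose F hF using h₁
  choose F' hF' using h₂
  refine ⟨⟨mkHom F fun a x => h₃ _ _ _ (hF _) (hr a _ _ (hF x)),
    mkHom F' fun a y => h₄ _ _ _ (hF' _) (hr a _ _ (hF' y)), ?_, ?_⟩, fun x => hF x⟩
  · exact hom_ext_apply fun x => h₄ _ _ _ (hF' _) (hF x)
  · exact hom_ext_apply fun y => h₃ _ _ _ (hF _) (hF' y)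

lemma pullback_ext {X Y Z : FinGSet.{u} G} {f : X ⟶ Z} {g : Y ⟶ Z} {p p' : (pullback f g).V}
    (h₁ : pullback.fst f g p = pullback.fst f g p')
    (h₂ : pullback.snd f g p = pullback.snd f g p') : p = p' := by
  obtain ⟨x, y, h, rfl⟩ := Concrete.pullbackMk_surjective f g p
  obtain ⟨x', y', h', rfl⟩ := Concrete.pullbackMk_surjective f g p'
  rw [Concrete.pullbackMk_fst, Concrete.pullbackMk_fst] at h₁
  rw [Concrete.pullbackMk_snd, Concrete.pullbackMk_snd] at h₂
  subst h₁ h₂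
  rfl

lemma pullback_exists {X Y Z : FinGSet.{u} G} (f : X ⟶ Z) (g : Y ⟶ Z) (x : X.V) (y : Y.V)
    (h : f x = g y) : ∃ p : (pullback f g).V, pullback.fst f g p = x ∧ pullback.snd f g p = y :=
  ⟨Concrete.pullbackMk f g x y h, Concrete.pullbackMk_fst .., Concrete.pullbackMk_snd ..⟩

/-- The point of a pullback with given coordinates. -/
noncomputable def pullbackPt {X Y Z : FinGSet.{u} G} (f : X ⟶ Z) (g : Y ⟶ Z) (x : X.V) (y : Y.V)
    (h : f x = g y) : (pullback f g).V :=
  (pullback_exists f g x y h).choose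

lemma fst_pullbackPt {X Y Z : FinGSet.{u} G} (f : X ⟶ Z) (g : Y ⟶ Z) (x : X.V) (y : Y.V)
    (h : f x = g y) : pullback.fst f g (pullbackPt f g x y h) = x :=
  (pullback_exists f g x y h).choose_spec.1

lemma snd_pullbackPt {X Y Z : FinGSet.{u} G} (f : X ⟶ Z) (g : Y ⟶ Z) (x : X.V) (y : Y.V)
    (h : f x = g y) : pullback.snd f g (pullbackPt f g x y h) = y :=
  (pullback_exists f g x y h).choose_spec.2

lemma pullback_condition_apply {X Y Z : FinGSet.{u} G} (f : X ⟶ Z) (g : Y ⟶ Z)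
    (p : (pullback f g).V) : f (pullback.fst f g p) = g (pullback.snd f g p) :=
  ConcreteCategory.congr_hom (pullback.condition (f := f) (g := g)) p

end Elements

section DependentProduct

variable {G : Type v} [Group G] {S T : FinGSet.{u} G}

/-- Pairs of a point `t` of `T` and a section of `X → S` over the fibre of `g` at `t`. -/
structure FibreSection (g : S ⟶ T) (X : Over S) where
  pt : T.V
  sec : {s : S.V // g s = pt} → X.left.V
  spec : ∀ s, X.hom (sec s) = s.1

namespace FibreSection

variable {g : S ⟶ T} {X : Over S}

lemma ext_apply {σ τ : FibreSection g X} (h : σ.pt = τ.pt)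
    (h' : ∀ s hs hs', σ.sec ⟨s, hs⟩ = τ.sec ⟨s, hs'⟩) : σ = τ := by
  obtain ⟨t, σ, hσ⟩ := σ
  obtain ⟨t', τ, hτ⟩ := τ
  obtain rfl : t = t' := h
  obtain rfl : σ = τ := funext fun s => h' s.1 s.2 s.2
  rfl

instance : Finite (FibreSection g X) := by
  let F : FibreSection g X → Σ t : T.V, ({s : S.V // g s = t} → X.left.V) :=
    fun σ => ⟨σ.pt, σ.sec⟩
  refine Finite.of_injective F ?_
  rintro ⟨t, σ, hσ⟩ ⟨t', σ', hσ'⟩ h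
  obtain ⟨rfl, h⟩ := Sigma.mk.inj h
  obtain rfl := eq_of_heq h
  rfl

instance : MulAction G (FibreSection g X) where
  smul a σ :=
    { pt := a • σ.pt
      sec s := a • σ.sec ⟨a⁻¹ • s.1, by rw [act_map, s.2, inv_smul_smul]⟩
      spec s := by rw [act_map, σ.spec, smul_inv_smul] }
  one_smul σ := by
    refine ext_apply (one_smul G σ.pt) fun s hs hs' => ?_
    change (1 : G) • σ.sec ⟨(1 : G)⁻¹ • s, _⟩ = _
    simp only [inv_one, one_smul]
  mul_smul a b σ := by
    refine ext_apply (mul_smul a b σ.pt) fun s hs hs' => ?_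
    change (a * b) • σ.sec ⟨(a * b)⁻¹ • s, _⟩ = a • b • σ.sec ⟨b⁻¹ • a⁻¹ • s, _⟩
    simp only [mul_inv_rev, mul_smul]

lemma smul_pt (a : G) (σ : FibreSection g X) : (a • σ).pt = (a • σ.pt : T.V) := rfl

lemma smul_sec (a : G) (σ : FibreSection g X) (s : S.V) (hs : g s = σ.pt) (hs') :
    (a • σ).sec ⟨(a • s : S.V), hs'⟩ = (a • σ.sec ⟨s, hs⟩ : X.left.V) := by
  change a • σ.sec ⟨a⁻¹ • a • s, _⟩ = _
  simp only [inv_smul_smul]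

variable (g X) in
/-- The `G`-set of sections over fibres, as an object over `T`. -/
def toOver : Over T :=
  Over.mk (mkHom (X := ofAct (FibreSection g X)) (Y := T) FibreSection.pt fun _ _ => rfl)

lemma sec_congr {σ τ : FibreSection g X} (h : σ = τ) {s s' : S.V} (hs : s = s') (h₁ h₂) :
    σ.sec ⟨s, h₁⟩ = τ.sec ⟨s', h₂⟩ := by
  subst h hs
  rfl

variable (g X) in
/-- Evaluation of sections. -/
noncomputable def ev : (Over.pullback g).obj (toOver g X) ⟶ X :=
  Over.homMk (mkHom
    (fun p : (pullback (toOver g X).hom g).V =>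
      (pullback.fst (toOver g X).hom g p : FibreSection g X).sec
        ⟨pullback.snd (toOver g X).hom g p, (pullback_condition_apply _ _ p).symm⟩)
    (by
      intro a p
      refine (sec_congr (act_map _ a p) (act_map _ a p) _ ?_).trans
        (smul_sec a (pullback.fst (toOver g X).hom g p : FibreSection g X) _ _ _)
      rw [← act_map (pullback.snd (toOver g X).hom g) a p]
      exact (pullback_condition_apply (toOver g X).hom g (a • p)).symm.trans
        (congrArg (toOver g X).hom (act_map _ a p))))
    (hom_ext_apply fun p =>
      (pullback.fst (toOver g X).hom g p : FibreSection g X).spec _)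

lemma ev_apply (p : (pullback (toOver g X).hom g).V) (σ : FibreSection g X) (s : S.V)
    (h₁ : pullback.fst (toOver g X).hom g p = σ) (h₂ : pullback.snd (toOver g X).hom g p = s)
    (h : g s = σ.pt) :
    (ev g X).left p = σ.sec ⟨s, h⟩ := by
  subst h₁ h₂
  rfl

/-- Evaluation of an arbitrary object over `T` with a map from its pullback. -/
noncomputable def evalAt {E : Over T} (ε : (Over.pullback g).obj E ⟶ X) (e : E.left.V) (s : S.V)
    (h : g s = E.hom e) : X.left.V :=
  ε.left (pullbackPt E.hom g e s h.symm)

lemma apply_eq_evalAt {E : Over T} (ε : (Over.pullback g).obj E ⟶ X)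
    (p : (pullback E.hom g).V) (e : E.left.V) (s : S.V)
    (h₁ : pullback.fst E.hom g p = e) (h₂ : pullback.snd E.hom g p = s) (h : g s = E.hom e) :
    ε.left p = evalAt ε e s h :=
  congrArg ε.left (pullback_ext (h₁.trans (fst_pullbackPt ..).symm)
    (h₂.trans (snd_pullbackPt ..).symm))

lemma hom_evalAt {E : Over T} (ε : (Over.pullback g).obj E ⟶ X) (e : E.left.V) (s : S.V)
    (h : g s = E.hom e) : X.hom (evalAt ε e s h) = s :=
  (ConcreteCategory.congr_hom (Over.w ε) _).trans (snd_pullbackPt E.hom g e s h.symm)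

lemma evalAt_smul {E : Over T} (ε : (Over.pullback g).obj E ⟶ X) (a : G) (e : E.left.V) (s : S.V)
    (h : g s = E.hom e) (h') :
    evalAt ε (a • e) (a • s) h' = (a • evalAt ε e s h : X.left.V) := by
  refine Eq.trans ?_ (act_map ε.left a (pullbackPt E.hom g e s h.symm))
  refine (apply_eq_evalAt ε _ _ _ ?_ ?_ _).symm
  · exact (act_map _ _ _).trans (congrArg _ (fst_pullbackPt ..))
  · exact (act_map _ _ _).trans (congrArg _ (snd_pullbackPt ..))

/-- The map into the `G`-set of sections determined by a map from a pullback. -/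
noncomputable def lift {E : Over T} (ε : (Over.pullback g).obj E ⟶ X) : E ⟶ toOver g X :=
  Over.homMk (mkHom (Y := ofAct (FibreSection g X))
    (fun e => (⟨E.hom e, fun s => evalAt ε e s.1 s.2, fun s => hom_evalAt ..⟩ : FibreSection g X))
    (by
      intro a e
      refine ext_apply (act_map E.hom a e) fun s hs hs' => ?_
      obtain ⟨s, rfl⟩ : ∃ s' : S.V, s = a • s' := ⟨a⁻¹ • s, (smul_inv_smul a s).symm⟩
      have h : g s = E.hom e := by
        have h := hs
        dsimp only at h
        rwa [act_map, act_map, smul_left_cancel_iff] at h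
      exact (evalAt_smul ε a e s h hs).trans (smul_sec a (⟨E.hom e, fun s => evalAt ε e s.1 s.2, fun s => hom_evalAt ..⟩ : FibreSection g X) s h hs').symm))
    (hom_ext_apply fun e => rfl)

lemma pullback_map_fst {E E' : Over T} (m : E ⟶ E') (p : (pullback E.hom g).V) :
    pullback.fst E'.hom g (((Over.pullback g).map m).left p) = m.left (pullback.fst E.hom g p) :=
  ConcreteCategory.congr_hom (pullback.lift_fst (f := E'.hom) (g := g)
    (pullback.fst E.hom g ≫ m.left) (pullback.snd E.hom g) (by simp [pullback.condition])) p

lemma pullback_map_snd {E E' : Over T} (m : E ⟶ E') (p : (pullback E.hom g).V) :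
    pullback.snd E'.hom g (((Over.pullback g).map m).left p) = pullback.snd E.hom g p :=
  ConcreteCategory.congr_hom (pullback.lift_snd (f := E'.hom) (g := g)
    (pullback.fst E.hom g ≫ m.left) (pullback.snd E.hom g) (by simp [pullback.condition])) p

lemma over_w {E E' : Over T} (m : E ⟶ E') (e : E.left.V) : E'.hom (m.left e) = E.hom e :=
  ConcreteCategory.congr_hom (Over.w m) e

lemma evalAt_comp {E E' : Over T} (m : E ⟶ E') (ε : (Over.pullback g).obj E' ⟶ X) (e : E.left.V)
    (s : S.V) (h : g s = E.hom e) (h') :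
    evalAt ((Over.pullback g).map m ≫ ε) e s h = evalAt ε (m.left e) s h' := by
  refine apply_eq_evalAt ε (((Over.pullback g).map m).left _) _ _ ?_ ?_ h'
  · rw [pullback_map_fst, fst_pullbackPt]
  · rw [pullback_map_snd, snd_pullbackPt]

lemma evalAt_ev (σ : FibreSection g X) (s : S.V) (h : g s = σ.pt) :
    evalAt (E := toOver g X) (ev g X) σ s h = σ.sec ⟨s, h⟩ :=
  ev_apply _ σ s (fst_pullbackPt ..) (snd_pullbackPt ..) h

lemma lift_ev {E : Over T} (ε : (Over.pullback g).obj E ⟶ X) :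
    (Over.pullback g).map (lift ε) ≫ ev g X = ε := by
  ext1
  refine hom_ext_apply fun (p : (pullback E.hom g).V) => ?_
  have h := (pullback_condition_apply E.hom g p).symm
  rw [apply_eq_evalAt _ p _ _ rfl rfl h, apply_eq_evalAt ε p _ _ rfl rfl h,
    evalAt_comp _ _ _ _ _ h]
  exact evalAt_ev ((lift ε).left (pullback.fst E.hom g p)) (pullback.snd E.hom g p) h

lemma lift_unique {E : Over T} (ε : (Over.pullback g).obj E ⟶ X) (m : E ⟶ toOver g X)
    (hm : (Over.pullback g).map m ≫ ev g X = ε) : m = lift ε := by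
  subst hm
  ext1
  refine hom_ext_apply fun e => ext_apply (over_w m e) fun s hs hs' => ?_
  refine (evalAt_ev (m.left e : FibreSection g X) s hs).symm.trans ?_
  exact (evalAt_comp m (ev g X) e s hs' hs).symm

/-- The section `G`-set is terminal among objects over `T` equipped with an evaluation map. -/
noncomputable def isTerminal : IsTerminal (CostructuredArrow.mk (ev g X)) :=
  IsTerminal.ofUniqueHom (fun A => CostructuredArrow.homMk (lift A.hom) (lift_ev A.hom))
    fun A m => by
      ext1
      exact lift_unique _ _ (CostructuredArrow.w m)

end FibreSection

instance (g : S ⟶ T) : (Over.pullback g).IsLeftAdjoint :=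
  have (X : Over S) : HasTerminal (CostructuredArrow (Over.pullback g) X) :=
    FibreSection.isTerminal.hasTerminal
  isLeftAdjoint_of_costructuredArrowTerminals _

/-- The dependent product along `g`, the right adjoint of pullback along `g`. -/
noncomputable def dependentProduct (g : S ⟶ T) : Over S ⥤ Over T :=
  (Over.pullback g).rightAdjoint

/-- The adjunction between pullback and dependent product along `g`. -/
noncomputable def dependentProductAdj (g : S ⟶ T) : Over.pullback g ⊣ dependentProduct g :=
  Adjunction.ofIsLeftAdjoint _

section Evaluation

variable (g : S ⟶ T) (X : Over S)

lemma dependentProduct_exists_iso :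
    ∃ i : (dependentProduct g).obj X ≅ FibreSection.toOver g X,
      (Over.pullback g).map i.hom ≫ FibreSection.ev g X =
        (dependentProductAdj g).counit.app X := by
  let i := (mkTerminalOfRightAdjoint _ (dependentProductAdj g) X).uniqueUpToIso
    (FibreSection.isTerminal (g := g) (X := X))
  exact ⟨(CostructuredArrow.proj _ _).mapIso i, CostructuredArrow.w i.hom⟩

lemma dependentProduct_ext (e e' : ((dependentProduct g).obj X).left.V)
    (h : ((dependentProduct g).obj X).hom e = ((dependentProduct g).obj X).hom e')
    (h' : ∀ s hs hs', FibreSection.evalAt ((dependentProductAdj g).counit.app X) e s hs =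
      FibreSection.evalAt ((dependentProductAdj g).counit.app X) e' s hs') : e = e' := by
  obtain ⟨i, hi⟩ := dependentProduct_exists_iso g X
  have key : i.hom.left e = i.hom.left e' := by
    refine FibreSection.ext_apply (((FibreSection.over_w i.hom e).trans h).trans
      (FibreSection.over_w i.hom e').symm) fun s hs hs' => ?_
    have h₁ := hs.trans (FibreSection.over_w i.hom e)
    have h₂ := hs'.trans (FibreSection.over_w i.hom e')
    have := h' s h₁ h₂
    rw [← hi, FibreSection.evalAt_comp _ _ _ _ _ hs, FibreSection.evalAt_comp _ _ _ _ _ hs'] at this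
    exact ((FibreSection.evalAt_ev _ s hs).symm.trans this).trans (FibreSection.evalAt_ev _ s hs')
  have h₃ := congrArg i.inv.left key
  have h₄ : ∀ x, i.inv.left (i.hom.left x) = x := fun x =>
    ConcreteCategory.congr_hom (congrArg CommaMorphism.left i.hom_inv_id) x
  rwa [h₄, h₄] at h₃

lemma dependentProduct_exists (σ : FibreSection g X) :
    ∃ e : ((dependentProduct g).obj X).left.V, ((dependentProduct g).obj X).hom e = σ.pt ∧
      ∀ s hs hs', FibreSection.evalAt ((dependentProductAdj g).counit.app X) e s hs =
        σ.sec ⟨s, hs'⟩ := by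
  obtain ⟨i, hi⟩ := dependentProduct_exists_iso g X
  have h₄ : i.hom.left (i.inv.left σ) = σ :=
    ConcreteCategory.congr_hom (congrArg CommaMorphism.left i.inv_hom_id) σ
  refine ⟨i.inv.left σ, FibreSection.over_w i.inv σ, fun s hs hs' => ?_⟩
  rw [← hi, FibreSection.evalAt_comp _ _ _ _ _
    (hs.trans (FibreSection.over_w i.hom _).symm)]
  refine (FibreSection.evalAt_ev (i.hom.left (i.inv.left σ) : FibreSection g X) s _).trans ?_
  exact FibreSection.sec_congr h₄ rfl _ _

end Evaluation

end DependentProduct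
end FinGSet

/-- A polynomial `S ← U₁ → U₂ → T` of finite `G`-sets. -/
structure GPoly {G : Type v} [Group G] (S T : FinGSet.{u} G) where
  U₁ : FinGSet.{u} G
  U₂ : FinGSet.{u} G
  /-- The restriction map. -/
  f : U₁ ⟶ S
  /-- The norm map. -/
  g : U₁ ⟶ U₂
  /-- The transfer map. -/
  h : U₂ ⟶ T

namespace GPoly

open FinGSet

variable {G : Type v} [Group G]

/-- An isomorphism of polynomials. -/
structure Iso {S T : FinGSet.{u} G} (P Q : GPoly S T) where
  e₁ : P.U₁ ≅ Q.U₁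
  e₂ : P.U₂ ≅ Q.U₂
  wf : e₁.hom ≫ Q.f = P.f
  wg : e₁.hom ≫ Q.g = P.g ≫ e₂.hom
  wh : e₂.hom ≫ Q.h = P.h

/-- The relation of being isomorphic polynomials. -/
instance isoSetoid (S T : FinGSet.{u} G) : Setoid (GPoly S T) where
  r P Q := Nonempty (Iso P Q)
  iseqv :=
    { refl P := ⟨⟨CategoryTheory.Iso.refl _, CategoryTheory.Iso.refl _, by simp, by simp, by simp⟩⟩
      symm := fun ⟨i⟩ => ⟨⟨i.e₁.symm, i.e₂.symm, by simp [← i.wf],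
        by simp [CategoryTheory.Iso.inv_comp_eq, reassoc_of% i.wg], by simp [← i.wh]⟩⟩
      trans := fun ⟨i⟩ ⟨j⟩ => ⟨⟨i.e₁ ≪≫ j.e₁, i.e₂ ≪≫ j.e₂, by simp [j.wf, i.wf],
        by simp [j.wg, reassoc_of% i.wg], by simp [j.wh, i.wh]⟩⟩ }

/-- The identity polynomial. -/
def id (S : FinGSet.{u} G) : GPoly S S := ⟨S, S, 𝟙 S, 𝟙 S, 𝟙 S⟩

section Comp

variable {S T U : FinGSet.{u} G} (P : GPoly S T) (Q : GPoly T U)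

/-- The base change of the transfer map of `P` along the restriction map of `Q`, as an object over
the source of the norm map of `Q`. -/
noncomputable def baseChange : Over Q.U₁ := Over.mk (pullback.fst Q.f P.h)

/-- The object over `Q.U₂` in the exponential diagram which interchanges the norm map of `Q` with
`baseChange P Q`. -/
noncomputable def prodObj : Over Q.U₂ := (dependentProduct Q.g).obj (baseChange P Q)

/-- The map from the pullback of `prodObj P Q` along `Q.g` to `baseChange P Q`. -/
noncomputable def counit : (Over.pullback Q.g).obj (prodObj P Q) ⟶ baseChange P Q :=
  (dependentProductAdj Q.g).counit.app (baseChange P Q)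

/-- The map along which the norm map of `P` is pulled back. -/
noncomputable def restr : pullback (prodObj P Q).hom Q.g ⟶ P.U₂ :=
  (counit P Q).left ≫ pullback.snd Q.f P.h

/-- The composite `Q ∘ P` of polynomials `S ← P.U₁ → P.U₂ → T` and `T ← Q.U₁ → Q.U₂ → U`:
first the transfer along `P.h` is moved past the restriction along `Q.f` by a pullback square, then
past the norm along `Q.g` by an exponential diagram, and finally the norm along `P.g` is moved past
the resulting restriction by a pullback square. -/
noncomputable def comp : GPoly S U where
  U₁ := pullback P.g (restr P Q)
  U₂ := (prodObj P Q).left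
  f := pullback.fst P.g (restr P Q) ≫ P.f
  g := pullback.snd P.g (restr P Q) ≫ pullback.fst (prodObj P Q).hom Q.g
  h := (prodObj P Q).hom ≫ Q.h

end Comp

/-- A description of a composite in terms of points: the points of `R.U₂` are the sections of
`P.U₂ ×[T] Q.U₁ → Q.U₁` over fibres of `Q.g`, and the points of `R.U₁` are triples consisting of a
point `e` of `R.U₂`, a point in the fibre of `Q.g` at `e`, and a point in the fibre of `P.g` at the
value of the section there. -/
structure CompData {S T U : FinGSet.{u} G} (P : GPoly S T) (Q : GPoly T U) (R : GPoly S U) where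
  d : R.U₂.V → Q.U₂.V
  s : ∀ (e : R.U₂.V) (c : Q.U₁.V), Q.g c = d e → P.U₂.V
  k : R.U₁.V → Q.U₁.V
  a : R.U₁.V → P.U₁.V
  d_smul : ∀ (x : G) e, d (x • e) = (x • d e : Q.U₂.V)
  k_smul : ∀ (x : G) e, k (x • e) = (x • k e : Q.U₁.V)
  a_smul : ∀ (x : G) e, a (x • e) = (x • a e : P.U₁.V)
  s_smul : ∀ (x : G) e c hc hc', s (x • e) (x • c) hc' = (x • s e c hc : P.U₂.V)
  h_s : ∀ e c hc, P.h (s e c hc) = Q.f c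
  h_eq : ∀ e, R.h e = Q.h (d e)
  g_k : ∀ y, Q.g (k y) = d (R.g y)
  g_a : ∀ y, P.g (a y) = s (R.g y) (k y) (g_k y)
  f_eq : ∀ y, R.f y = P.f (a y)
  ext₂ : ∀ e e', d e = d e' → (∀ c hc hc', s e c hc = s e' c hc') → e = e'
  ex₂ : ∀ (d₀ : Q.U₂.V) (s₀ : ∀ c : Q.U₁.V, Q.g c = d₀ → P.U₂.V),
    (∀ c hc, P.h (s₀ c hc) = Q.f c) → ∃ e, d e = d₀ ∧ ∀ c hc hc', s e c hc = s₀ c hc'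
  ext₁ : ∀ y y', R.g y = R.g y' → k y = k y' → a y = a y' → y = y'
  ex₁ : ∀ e c a₀ hc, P.g a₀ = s e c hc → ∃ y, R.g y = e ∧ k y = c ∧ a y = a₀

namespace CompData

lemma s_congr {S T U : FinGSet.{u} G} {P : GPoly S T} {Q : GPoly T U} {R : GPoly S U}
    (D : CompData P Q R) {e e' c c'} (he : e = e') (hc : c = c') (h h') :
    D.s e c h = D.s e' c' h' := by
  subst he hc
  rfl

/-- The points of a composite. -/
noncomputable def ofComp {S T U : FinGSet.{u} G} (P : GPoly S T) (Q : GPoly T U) :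
    CompData P Q (comp P Q) where
  d e := (prodObj P Q).hom e
  s e c hc := pullback.snd Q.f P.h (FibreSection.evalAt (counit P Q) e c hc)
  k y := pullback.snd (prodObj P Q).hom Q.g (pullback.snd P.g (restr P Q) y)
  a y := pullback.fst P.g (restr P Q) y
  d_smul x e := act_map (prodObj P Q).hom x e
  k_smul x e := by
    refine (congrArg _ (act_map _ _ _)).trans (act_map _ _ _)
  a_smul x e := act_map _ _ _
  s_smul x e c hc hc' := (congrArg _ (FibreSection.evalAt_smul _ x e c hc hc')).trans
    (act_map _ _ _)
  h_s e c hc := (pullback_condition_apply Q.f P.h _).symm.trans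
    (congrArg Q.f (FibreSection.hom_evalAt (counit P Q) e c hc))
  h_eq e := rfl
  g_k y := (pullback_condition_apply (prodObj P Q).hom Q.g _).symm
  g_a y := (pullback_condition_apply P.g (restr P Q) y).trans
    (congrArg (pullback.snd Q.f P.h) (FibreSection.apply_eq_evalAt _ _ _ _ rfl rfl _))
  f_eq y := rfl
  ext₂ e e' h h' := by
    refine dependentProduct_ext Q.g (baseChange P Q) e e' h fun s hs hs' => ?_
    refine pullback_ext ?_ (h' s hs hs')
    exact (FibreSection.hom_evalAt (counit P Q) e s hs).trans
      (FibreSection.hom_evalAt (counit P Q) e' s hs').symm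
  ex₂ d₀ s₀ h := by
    obtain ⟨e, he, he'⟩ := dependentProduct_exists Q.g (baseChange P Q)
      ⟨d₀, fun c => pullbackPt Q.f P.h c.1 (s₀ c.1 c.2) (h _ _).symm,
        fun c => fst_pullbackPt ..⟩
    refine ⟨e, he, fun c hc hc' => ?_⟩
    exact (congrArg (pullback.snd Q.f P.h) (he' c hc hc')).trans (snd_pullbackPt _ _ _ _ (h _ _).symm)
  ext₁ y y' h₁ h₂ h₃ := pullback_ext h₃ (pullback_ext h₁ h₂)
  ex₁ e c a₀ hc h := by
    have h' : P.g a₀ = restr P Q (pullbackPt (prodObj P Q).hom Q.g e c hc.symm) :=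
      h
    refine ⟨pullbackPt _ _ _ _ h', ?_, ?_, ?_⟩
    · exact (congrArg (pullback.fst (prodObj P Q).hom Q.g) (snd_pullbackPt ..)).trans
        (fst_pullbackPt ..)
    · exact (congrArg (pullback.snd (prodObj P Q).hom Q.g) (snd_pullbackPt ..)).trans
        (snd_pullbackPt ..)
    · exact fst_pullbackPt ..

/-- Points of a composite only depend on the isomorphism classes of the factors. -/
def transport {S T U : FinGSet.{u} G} {P P' : GPoly S T} {Q Q' : GPoly T U} {R : GPoly S U}
    (i : Iso P P') (j : Iso Q Q') (D : CompData P Q R) : CompData P' Q' R :=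
  have i₁ : ∀ x, i.e₁.inv (i.e₁.hom x) = x := ConcreteCategory.congr_hom i.e₁.hom_inv_id
  have i₁' : ∀ x, i.e₁.hom (i.e₁.inv x) = x := ConcreteCategory.congr_hom i.e₁.inv_hom_id
  have i₂ : ∀ x, i.e₂.inv (i.e₂.hom x) = x := ConcreteCategory.congr_hom i.e₂.hom_inv_id
  have i₂' : ∀ x, i.e₂.hom (i.e₂.inv x) = x := ConcreteCategory.congr_hom i.e₂.inv_hom_id
  have j₁ : ∀ x, j.e₁.inv (j.e₁.hom x) = x := ConcreteCategory.congr_hom j.e₁.hom_inv_id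
  have j₁' : ∀ x, j.e₁.hom (j.e₁.inv x) = x := ConcreteCategory.congr_hom j.e₁.inv_hom_id
  have j₂ : ∀ x, j.e₂.inv (j.e₂.hom x) = x := ConcreteCategory.congr_hom j.e₂.hom_inv_id
  have j₂' : ∀ x, j.e₂.hom (j.e₂.inv x) = x := ConcreteCategory.congr_hom j.e₂.inv_hom_id
  have if' : ∀ x, P'.f (i.e₁.hom x) = P.f x := ConcreteCategory.congr_hom i.wf
  have ig : ∀ x, P'.g (i.e₁.hom x) = i.e₂.hom (P.g x) := ConcreteCategory.congr_hom i.wg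
  have ih : ∀ x, P'.h (i.e₂.hom x) = P.h x := ConcreteCategory.congr_hom i.wh
  have jf : ∀ x, Q'.f (j.e₁.hom x) = Q.f x := ConcreteCategory.congr_hom j.wf
  have jg : ∀ x, Q'.g (j.e₁.hom x) = j.e₂.hom (Q.g x) := ConcreteCategory.congr_hom j.wg
  have jh : ∀ x, Q'.h (j.e₂.hom x) = Q.h x := ConcreteCategory.congr_hom j.wh
  have key : ∀ c d, Q'.g c = j.e₂.hom d → Q.g (j.e₁.inv c) = d := fun c d h => by
    have := jg (j.e₁.inv c)
    rw [j₁', h] at this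
    rw [← j₂ d, this, j₂]
  { d e := j.e₂.hom (D.d e)
    s e c hc := i.e₂.hom (D.s e (j.e₁.inv c) (key _ _ hc))
    k y := j.e₁.hom (D.k y)
    a y := i.e₁.hom (D.a y)
    d_smul x e := by rw [D.d_smul, act_map]
    k_smul x e := by rw [D.k_smul, act_map]
    a_smul x e := by rw [D.a_smul, act_map]
    s_smul x e c hc hc' := by
      rw [← act_map, ← D.s_smul]
      · exact congrArg _ (D.s_congr rfl (act_map _ _ _) _ _)
      · rw [← act_map]
        exact key _ _ hc'
    h_s e c hc := by rw [ih, D.h_s, ← jf, j₁']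
    h_eq e := by rw [jh, D.h_eq]
    g_k y := by rw [jg, D.g_k]
    g_a y := by
      rw [ig, D.g_a]
      exact congrArg _ (D.s_congr rfl (j₁ _).symm _ _)
    f_eq y := by rw [if', D.f_eq]
    ext₂ e e' h h' := by
      have hd : D.d e = D.d e' := by rw [← j₂ (D.d e), h, j₂]
      refine D.ext₂ e e' hd fun c hc hc' => ?_
      have := h' (j.e₁.hom c) (by rw [jg, hc]) (by rw [jg, hc'])
      have h₂ := congrArg i.e₂.inv this
      rw [i₂, i₂] at h₂
      exact (D.s_congr rfl (j₁ c).symm _ _).trans (h₂.trans (D.s_congr rfl (j₁ c) _ _))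
    ex₂ d₀ s₀ h := by
      obtain ⟨e, he, he'⟩ := D.ex₂ (j.e₂.inv d₀)
        (fun c hc => i.e₂.inv (s₀ (j.e₁.hom c) (by rw [jg, hc, j₂'])))
        (fun c hc => by rw [← ih, i₂', h, jf])
      refine ⟨e, by rw [he, j₂'], fun c hc hc' => ?_⟩
      rw [he' _ _ (by rw [← he]; exact key _ _ hc), i₂']
      congr 1
      exact j₁' c
    ext₁ y y' h₁ h₂ h₃ :=
      D.ext₁ y y' h₁ (by rw [← j₁ (D.k y), h₂, j₁]) (by rw [← i₁ (D.a y), h₃, i₁])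
    ex₁ e c a₀ hc h := by
      obtain ⟨y, h₁, h₂, h₃⟩ := D.ex₁ e (j.e₁.inv c) (i.e₁.inv a₀) (key _ _ hc) (by
        rw [← i₂ (P.g _), ← ig, i₁', h, i₂])
      exact ⟨y, h₁, by rw [h₂, j₁'], by rw [h₃, i₁']⟩ }

/-- The points of an iterated composite. -/
noncomputable def assoc {S T U V : FinGSet.{u} G} {P : GPoly S T} {Q : GPoly T U} {W : GPoly U V}
    {PQ : GPoly S U} {QW : GPoly T V} {X : GPoly S V}
    (A : CompData P Q PQ) (B : CompData Q W QW) (C : CompData PQ W X) : CompData P QW X :=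
  have E₂ : ∀ e, ∃ d, B.d d = C.d e ∧ ∀ c hc hc', B.s d c hc = A.d (C.s e c hc') := fun e =>
    B.ex₂ (C.d e) (fun c hc => A.d (C.s e c hc)) fun c hc => by rw [← A.h_eq, C.h_s]
  let d := fun e => (E₂ e).choose
  have d₁ : ∀ e, B.d (d e) = C.d e := fun e => (E₂ e).choose_spec.1
  have d₂ : ∀ e c hc hc', B.s (d e) c hc = A.d (C.s e c hc') := fun e => (E₂ e).choose_spec.2
  have E₁ : ∀ y, ∃ z, QW.g z = d (X.g y) ∧ B.k z = C.k y ∧ B.a z = A.k (C.a y) := fun y =>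
    B.ex₁ _ _ _ (by rw [C.g_k, d₁]) (by rw [d₂ _ _ _ (C.g_k y), A.g_k, C.g_a])
  let k := fun y => (E₁ y).choose
  have k₁ : ∀ y, QW.g (k y) = d (X.g y) := fun y => (E₁ y).choose_spec.1
  have k₂ : ∀ y, B.k (k y) = C.k y := fun y => (E₁ y).choose_spec.2.1
  have k₃ : ∀ y, B.a (k y) = A.k (C.a y) := fun y => (E₁ y).choose_spec.2.2
  have hk : ∀ e z, QW.g z = d e → W.g (B.k z) = C.d e := fun e z hz => by rw [B.g_k, hz, d₁]
  have ha : ∀ e z hz, Q.g (B.a z) = A.d (C.s e (B.k z) (hk e z hz)) := fun e z hz => by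
    rw [B.g_a, B.s_congr hz rfl _ (by rw [hk e z hz, d₁])]
    exact d₂ ..
  have d_smul : ∀ (x : G) e, d (x • e) = (x • d e : QW.U₂.V) := fun x e => by
    have h₀ : B.d (d (x • e)) = B.d (x • d e) := by rw [d₁, C.d_smul, B.d_smul, d₁]
    refine B.ext₂ _ _ h₀ fun c hc hc' => ?_
    obtain ⟨c, rfl⟩ : ∃ c' : W.U₁.V, c = x • c' := ⟨x⁻¹ • c, (smul_inv_smul x c).symm⟩
    have h₁ : W.g c = B.d (d e) := by
      rwa [B.d_smul, act_map, smul_left_cancel_iff] at hc'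
    have h₂ : W.g c = C.d e := h₁.trans (d₁ e)
    rw [B.s_smul x _ c h₁, d₂ _ _ _ h₂, ← A.d_smul, ← C.s_smul x e c h₂ (by
      rw [hc, d₁])]
    exact d₂ ..
  { d := d
    s e z hz := A.s (C.s e (B.k z) (hk e z hz)) (B.a z) (ha e z hz)
    k := k
    a y := A.a (C.a y)
    d_smul := d_smul
    k_smul x y := B.ext₁ _ _
      (by rw [k₁, act_map, act_map, k₁, d_smul])
      (by rw [k₂, B.k_smul, k₂, C.k_smul])
      (by rw [k₃, B.a_smul, k₃, C.a_smul, A.k_smul])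
    a_smul x e := by rw [C.a_smul, A.a_smul]
    s_smul x e c hc hc' := by
      rw [← A.s_smul x _ _ (ha e c hc) (by rw [act_map, A.d_smul, ha e c hc])]
      · refine A.s_congr ?_ (B.a_smul _ _) _ _
        rw [← C.s_smul x e _ (hk e c hc) (by rw [act_map, C.d_smul, hk e c hc])]
        exact C.s_congr rfl (B.k_smul _ _) _ _
    h_s e c hc := by rw [A.h_s, B.f_eq]
    h_eq e := by rw [C.h_eq, B.h_eq, d₁]
    g_k := k₁
    g_a y := by
      rw [A.g_a]
      exact A.s_congr ((C.g_a y).trans (C.s_congr rfl (k₂ y).symm _ _)) (k₃ y).symm _ _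
    f_eq y := by rw [C.f_eq, A.f_eq]
    ext₂ e e' h h' := by
      have h₀ : C.d e = C.d e' := by rw [← d₁, h, d₁]
      refine C.ext₂ _ _ h₀ fun c hc hc' => ?_
      have hB : W.g c = B.d (d e) := by rw [hc, d₁]
      have hB' : W.g c = B.d (d e') := by rw [hc', d₁]
      have h₁ : A.d (C.s e c hc) = A.d (C.s e' c hc') := by
        rw [← d₂ _ _ hB, ← d₂ _ _ hB']
        exact B.s_congr h rfl _ _
      refine A.ext₂ _ _ h₁ fun q hq hq' => ?_
      obtain ⟨z, hz₁, rfl, rfl⟩ := B.ex₁ (d e) c q hB (by rw [hq, d₂])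
      exact h' z hz₁ (hz₁.trans h)
    ex₂ d₀ s₀ h := by
      have Z : ∀ c hc q, Q.g q = B.s d₀ c hc → ∃ z, QW.g z = d₀ ∧ B.k z = c ∧ B.a z = q :=
        fun c hc q hq => B.ex₁ _ _ _ hc hq
      choose z z₁ z₂ z₃ using Z
      have Y := fun c hc => A.ex₂ (B.s d₀ c hc) (fun q hq => s₀ (z c hc q hq) (z₁ c hc q hq))
        fun q hq => by rw [h, B.f_eq, z₃]
      choose y y₁ y₂ using Y
      obtain ⟨e, he, he'⟩ := C.ex₂ (B.d d₀) y fun c hc => by rw [A.h_eq, y₁, B.h_s]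
      have hd : d e = d₀ := B.ext₂ _ _ (by rw [d₁, he]) fun c hc hc' => by
        rw [d₂ _ _ _ (by rw [hc', he]), he' _ _ hc', y₁]
      refine ⟨e, hd, fun c hc hc' => ?_⟩
      have hc₁ : W.g (B.k c) = B.d d₀ := by rw [B.g_k, hc']
      have hc₂ : Q.g (B.a c) = B.s d₀ (B.k c) hc₁ := by
        rw [B.g_a]
        exact B.s_congr hc' rfl _ _
      rw [A.s_congr (he' _ _ hc₁) rfl _ (by rw [y₁, hc₂]), y₂ _ _ _ _ hc₂]
      congr 1
      exact B.ext₁ _ _ (by rw [z₁, hc']) (z₂ ..) (z₃ ..)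
    ext₁ y y' h₁ h₂ h₃ := C.ext₁ _ _ h₁ (by rw [← k₂, h₂, k₂]) (A.ext₁ _ _
      (by
        rw [C.g_a, C.g_a]
        exact C.s_congr h₁ (by rw [← k₂, h₂, k₂]) _ _)
      (by rw [← k₃, h₂, k₃]) h₃)
    ex₁ e c a₀ hc h := by
      obtain ⟨y, hy₁, hy₂, hy₃⟩ := A.ex₁ _ _ _ (ha e c hc) h
      obtain ⟨x, hx₁, hx₂, hx₃⟩ := C.ex₁ _ _ _ (hk e c hc) hy₁
      exact ⟨x, hx₁, B.ext₁ _ _ (by rw [k₁, hx₁, hc]) (by rw [k₂, hx₂]) (by rw [k₃, hx₃, hy₂]),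
        by rw [hx₃, hy₃]⟩ }

/-- The points of a composite with an identity polynomial. -/
def idLeft {S T : FinGSet.{u} G} (Q : GPoly S T) : CompData (GPoly.id S) Q Q where
  d e := e
  s _ c _ := Q.f c
  k y := y
  a y := Q.f y
  d_smul _ _ := rfl
  k_smul _ _ := rfl
  a_smul _ _ := act_map _ _ _
  s_smul _ _ _ _ _ := act_map _ _ _
  h_s _ _ _ := rfl
  h_eq _ := rfl
  g_k _ := rfl
  g_a _ := rfl
  f_eq _ := rfl
  ext₂ _ _ h _ := h
  ex₂ d₀ _ h := ⟨d₀, rfl, fun c _ hc' => (h c hc').symm⟩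
  ext₁ _ _ _ h _ := h
  ex₁ _ c _ hc h := ⟨c, hc, rfl, h.symm⟩

/-- The points of a composite with an identity polynomial. -/
def idRight {S T : FinGSet.{u} G} (P : GPoly S T) : CompData P (GPoly.id T) P where
  d e := P.h e
  s e _ _ := e
  k y := P.h (P.g y)
  a y := y
  d_smul _ _ := act_map _ _ _
  k_smul _ _ := (congrArg _ (act_map _ _ _)).trans (act_map _ _ _)
  a_smul _ _ := rfl
  s_smul _ _ _ _ _ := rfl
  h_s _ _ hc := hc.symm
  h_eq _ := rfl
  g_k _ := rfl
  g_a _ := rfl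
  f_eq _ := rfl
  ext₂ e e' h h' := h' (P.h e) rfl h
  ex₂ d₀ s₀ h := ⟨s₀ d₀ rfl, h d₀ rfl, fun c _ hc' => by
    obtain rfl : c = d₀ := hc'
    rfl⟩
  ext₁ _ _ _ _ h := h
  ex₁ e c a₀ hc h := ⟨a₀, h, (congrArg P.h h).trans hc.symm, rfl⟩

end CompData

lemma equiv_of_rel {S T : FinGSet.{u} G} {P Q : GPoly S T}
    (r₁ : P.U₁.V → Q.U₁.V → Prop) (r₂ : P.U₂.V → Q.U₂.V → Prop)
    (s₁ : ∀ (a : G) x y, r₁ x y → r₁ (a • x : P.U₁.V) (a • y : Q.U₁.V))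
    (s₂ : ∀ (a : G) x y, r₂ x y → r₂ (a • x : P.U₂.V) (a • y : Q.U₂.V))
    (e₁ : ∀ x, ∃ y, r₁ x y) (e₂ : ∀ x, ∃ y, r₂ x y)
    (e₁' : ∀ y, ∃ x, r₁ x y) (e₂' : ∀ y, ∃ x, r₂ x y)
    (u₁ : ∀ x y y', r₁ x y → r₁ x y' → y = y') (u₂ : ∀ x y y', r₂ x y → r₂ x y' → y = y')
    (u₁' : ∀ x x' y, r₁ x y → r₁ x' y → x = x') (u₂' : ∀ x x' y, r₂ x y → r₂ x' y → x = x')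
    (wf : ∀ x y, r₁ x y → Q.f y = P.f x) (wg : ∀ x y, r₁ x y → r₂ (P.g x) (Q.g y))
    (wh : ∀ x y, r₂ x y → Q.h y = P.h x) : P ≈ Q := by
  obtain ⟨i₁, h₁⟩ := exists_iso r₁ s₁ e₁ e₁' u₁ u₁'
  obtain ⟨i₂, h₂⟩ := exists_iso r₂ s₂ e₂ e₂' u₂ u₂'
  exact ⟨⟨i₁, i₂, hom_ext_apply fun x => wf _ _ (h₁ x),
    hom_ext_apply fun x => u₂ _ _ _ (wg _ _ (h₁ x)) (h₂ _),
    hom_ext_apply fun x => wh _ _ (h₂ x)⟩⟩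

lemma CompData.unique {S T U : FinGSet.{u} G} {P : GPoly S T} {Q : GPoly T U} {R R' : GPoly S U}
    (D : CompData P Q R) (D' : CompData P Q R') : R ≈ R' := by
  let r₂ : R.U₂.V → R'.U₂.V → Prop := fun e e' =>
    D.d e = D'.d e' ∧ ∀ c hc hc', D.s e c hc = D'.s e' c hc'
  have s₂ : ∀ (a : G) x y, r₂ x y → r₂ (a • x : R.U₂.V) (a • y : R'.U₂.V) := by
    rintro a e e' ⟨h, h'⟩
    refine ⟨by rw [D.d_smul, D'.d_smul, h], fun c hc hc' => ?_⟩
    obtain ⟨c, rfl⟩ : ∃ c' : Q.U₁.V, c = a • c' := ⟨a⁻¹ • c, (smul_inv_smul a c).symm⟩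
    have h₁ : Q.g c = D.d e := by rwa [D.d_smul, act_map, smul_left_cancel_iff] at hc
    have h₂ : Q.g c = D'.d e' := h₁.trans h
    rw [D.s_smul a e c h₁, D'.s_smul a e' c h₂, h' c h₁ h₂]
  refine equiv_of_rel (fun y y' => r₂ (R.g y) (R'.g y') ∧ D.k y = D'.k y' ∧ D.a y = D'.a y') r₂
    ?_ s₂ ?_ ?_ ?_ ?_ ?_ ?_ ?_ ?_ ?_ ?_ ?_
  · rintro a y y' ⟨h₁, h₂, h₃⟩
    refine ⟨?_, by rw [D.k_smul, D'.k_smul, h₂], by rw [D.a_smul, D'.a_smul, h₃]⟩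
    rw [act_map, act_map]
    exact s₂ _ _ _ h₁
  · intro y
    obtain ⟨e, h₁, h₂⟩ := D'.ex₂ (D.d (R.g y)) (D.s (R.g y)) (D.h_s _)
    have hk : Q.g (D.k y) = D'.d e := (D.g_k y).trans h₁.symm
    obtain ⟨y', rfl, h₃, h₄⟩ := D'.ex₁ e (D.k y) (D.a y) hk
      ((D.g_a y).trans (h₂ _ _ _).symm)
    exact ⟨y', ⟨h₁.symm, fun c hc hc' => (h₂ c hc' hc).symm⟩, h₃.symm, h₄.symm⟩
  · intro e
    obtain ⟨e, h₁, h₂⟩ := D'.ex₂ (D.d e) (D.s e) (D.h_s _)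
    exact ⟨e, h₁.symm, fun c hc hc' => (h₂ c hc' hc).symm⟩
  · intro y
    obtain ⟨e, h₁, h₂⟩ := D.ex₂ (D'.d (R'.g y)) (D'.s (R'.g y)) (D'.h_s _)
    have hk : Q.g (D'.k y) = D.d e := (D'.g_k y).trans h₁.symm
    obtain ⟨y', rfl, h₃, h₄⟩ := D.ex₁ e (D'.k y) (D'.a y) hk
      ((D'.g_a y).trans (h₂ _ _ _).symm)
    exact ⟨y', ⟨h₁, fun c hc hc' => h₂ c hc hc'⟩, h₃, h₄⟩
  · intro e
    obtain ⟨e, h₁, h₂⟩ := D.ex₂ (D'.d e) (D'.s e) (D'.h_s _)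
    exact ⟨e, h₁, fun c hc hc' => h₂ c hc hc'⟩
  · rintro x y y' ⟨⟨h₁, h₂⟩, h₃, h₄⟩ ⟨⟨h₁', h₂'⟩, h₃', h₄'⟩
    exact D'.ext₁ _ _ (D'.ext₂ _ _ (h₁.symm.trans h₁') fun c hc hc' =>
      (h₂ c (hc.trans h₁.symm) hc).symm.trans (h₂' _ _ _)) (h₃.symm.trans h₃') (h₄.symm.trans h₄')
  · rintro x y y' ⟨h₁, h₂⟩ ⟨h₁', h₂'⟩
    exact D'.ext₂ _ _ (h₁.symm.trans h₁') fun c hc hc' =>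
      (h₂ c (hc.trans h₁.symm) hc).symm.trans (h₂' _ _ _)
  · rintro x x' y ⟨⟨h₁, h₂⟩, h₃, h₄⟩ ⟨⟨h₁', h₂'⟩, h₃', h₄'⟩
    exact D.ext₁ _ _ (D.ext₂ _ _ (h₁.trans h₁'.symm) fun c hc hc' =>
      (h₂ c hc (hc.trans h₁)).trans (h₂' _ _ _).symm) (h₃.trans h₃'.symm) (h₄.trans h₄'.symm)
  · rintro x x' y ⟨h₁, h₂⟩ ⟨h₁', h₂'⟩
    exact D.ext₂ _ _ (h₁.trans h₁'.symm) fun c hc hc' =>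
      (h₂ c hc (hc.trans h₁)).trans (h₂' _ _ _).symm
  · rintro y y' ⟨-, -, h⟩
    rw [D.f_eq, D'.f_eq, h]
  · rintro y y' ⟨h, -⟩
    exact h
  · rintro e e' ⟨h, -⟩
    rw [D.h_eq, D'.h_eq, h]

lemma comp_congr {S T U : FinGSet.{u} G} {P P' : GPoly S T} {Q Q' : GPoly T U} (hP : P ≈ P')
    (hQ : Q ≈ Q') : comp P Q ≈ comp P' Q' := by
  obtain ⟨i⟩ := hP
  obtain ⟨j⟩ := hQ
  exact ((CompData.ofComp P Q).transport i j).unique (CompData.ofComp P' Q')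

lemma comp_assoc {S T U V : FinGSet.{u} G} (P : GPoly S T) (Q : GPoly T U) (W : GPoly U V) :
    comp (comp P Q) W ≈ comp P (comp Q W) :=
  ((CompData.ofComp P Q).assoc (CompData.ofComp Q W) (CompData.ofComp _ W)).unique
    (CompData.ofComp _ _)

end GPoly

/-- The category of polynomials: the objects are the finite `G`-sets. -/
structure PolyCat (G : Type v) [Group G] where
  of ::
  /-- The underlying finite `G`-set. -/
  obj : FinGSet.{u} G

namespace PolyCat

variable {G : Type v} [Group G]

/-- Morphisms are isomorphism classes of polynomials. -/
noncomputable instance : Category (PolyCat.{u} G) where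
  Hom S T := Quotient (GPoly.isoSetoid S.obj T.obj)
  id S := Quotient.mk _ (GPoly.id S.obj)
  comp p q := Quotient.map₂ GPoly.comp (fun _ _ h _ _ h' => GPoly.comp_congr h h') p q
  id_comp p := by
    induction p using Quotient.inductionOn with | _ p =>
    exact Quotient.sound ((GPoly.CompData.ofComp _ _).unique (GPoly.CompData.idLeft p))
  comp_id p := by
    induction p using Quotient.inductionOn with | _ p =>
    exact Quotient.sound ((GPoly.CompData.ofComp _ _).unique (GPoly.CompData.idRight p))
  assoc p q r := by
    induction p using Quotient.inductionOn with | _ p =>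
    induction q using Quotient.inductionOn with | _ q =>
    induction r using Quotient.inductionOn with | _ r =>
    exact Quotient.sound (GPoly.comp_assoc p q r)

/-- The morphism represented by a polynomial. -/
def mk {S T : PolyCat.{u} G} (p : GPoly S.obj T.obj) : S ⟶ T :=
  Quotient.mk (GPoly.isoSetoid S.obj T.obj) p

end PolyCat

/-- An indexing category: a class of maps of finite `G`-sets which contains the identities and is
closed under composition (a wide subcategory), is stable under pullback, and such that the
corresponding wide subcategory has finite coproducts, which are coproducts of finite `G`-sets. -/
class IsIndexingCategory {G : Type v} [Group G] (O : MorphismProperty (FinGSet.{u} G)) : Prop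
    extends O.IsMultiplicative, O.IsStableUnderBaseChange where
  hasFiniteCoproducts : HasFiniteCoproducts (WideSubcategory O)
  preservesFiniteCoproducts : PreservesFiniteCoproducts (wideSubcategoryInclusion O)

/-- `(Oa, Om)` is compatible: the dependent product along a map `g : S ⟶ T` in `Om` takes maps
`X ⟶ S` in `Oa` to maps in `Oa`. -/
def IsCompatible {G : Type v} [Group G] (Oa Om : MorphismProperty (FinGSet.{u} G)) : Prop :=
  ∀ ⦃S T : FinGSet.{u} G⦄ (g : S ⟶ T), Om g → ∀ X : Over S, Oa X.hom →
    Oa ((FinGSet.dependentProduct g).obj X).hom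

/-- The wide subgraph of the category of polynomials whose arrows are the isomorphism classes of
polynomials with norm map in `Om` and transfer map in `Oa`. -/
def polySubgraph {G : Type v} [Group G] (Oa Om : MorphismProperty (FinGSet.{u} G)) :
    MorphismProperty (PolyCat.{u} G) :=
  fun S T φ => ∃ p : GPoly S.obj T.obj, PolyCat.mk p = φ ∧ Om p.g ∧ Oa p.h

/-! The composite of two polynomials is an explicit diagram built from base changes, one dependent
product and compositions, so membership in the subgraph can be tested on representatives. Three
properties of the two classes matter: each contains the identities, each is closed under
composition, and each is stable under base change along arbitrary maps. No condition is ever placed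
on the restriction maps, and this is why base change along arbitrary maps is needed.

The norm map of a composite is a base change of the first norm map followed by a base change of the
second, so it stays in `Om` without any interaction between the two classes (`comp_norm_mem`). The
transfer map of a composite is the dependent product, along the second norm map, of a base change of
the first transfer map, followed by the second transfer map. The dependent product is the only
operation in which the two classes meet, and compatibility says exactly that it stays in `Oa`
(`comp_transfer_mem`).

An arrow of the subgraph is a class with at least one good representative. To pass to every
representative, `Iso.norm_transfer_mem` uses that both classes respect isomorphisms. This follows
from stability under base change, since a commutative square with two opposite sides invertible is a
pullback square. -/

namespace GPoly

variable {G : Type v} [Group G] {Oa Om : MorphismProperty (FinGSet.{u} G)}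

/-- Membership of the norm and transfer maps in isomorphism-invariant classes only depends on the
isomorphism class of a polynomial. -/
lemma Iso.norm_transfer_mem [Oa.RespectsIso] [Om.RespectsIso] {S T : FinGSet.{u} G}
    {P Q : GPoly S T} (i : Iso P Q) (h : Om P.g ∧ Oa P.h) : Om Q.g ∧ Oa Q.h := by
  -- The square `i.wg` exhibits `Q.g` as `P.g` up to isomorphisms at both ends; each end is removed
  -- by its own cancellation.
  have hg : Om (i.e₁.hom ≫ Q.g) := by
    rw [i.wg]
    exact (Om.cancel_right_of_respectsIso P.g i.e₂.hom).2 h.1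
  -- The target of a transfer map is fixed under isomorphism of polynomials, so only the source has
  -- to be corrected.
  have hh : Oa (i.e₂.hom ≫ Q.h) := by
    rw [i.wh]
    exact h.2
  exact ⟨(Om.cancel_left_of_respectsIso i.e₁.hom Q.g).1 hg,
    (Oa.cancel_left_of_respectsIso i.e₂.hom Q.h).1 hh⟩

/-- The two factors of the composite norm map are the base change of `P.g` along `restr P Q` and the
base change of `Q.g` along the structure map of `prodObj P Q`. The dependent product enters only
through maps along which one pulls back, so compatibility plays no role here. -/
lemma comp_norm_mem [Om.IsStableUnderComposition] [Om.IsStableUnderBaseChange]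
    {S T U : FinGSet.{u} G} (P : GPoly S T) (Q : GPoly T U) (hP : Om P.g) (hQ : Om Q.g) :
    Om (comp P Q).g :=
  Om.comp_mem _ _ (Om.pullback_snd P.g (restr P Q) hP)
    (Om.pullback_fst (prodObj P Q).hom Q.g hQ)

/-- This is where compatibility is used. Pulling `P.h` back along `Q.f` gives a map in `Oa` whose
target is the source of `Q.g`; since `Q.g` lies in `Om`, its dependent product along `Q.g` is again
in `Oa`, and composing with `Q.h` finishes. Thus the transfer of the composite depends on the norm
of the second polynomial but not on that of the first. -/
lemma comp_transfer_mem [Oa.IsStableUnderComposition] [Oa.IsStableUnderBaseChange]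
    (hcompat : IsCompatible Oa Om) {S T U : FinGSet.{u} G} (P : GPoly S T) (Q : GPoly T U)
    (hP : Oa P.h) (hQg : Om Q.g) (hQh : Oa Q.h) : Oa (comp P Q).h :=
  Oa.comp_mem _ _ (hcompat Q.g hQg (baseChange P Q) (Oa.pullback_fst Q.f P.h hP)) hQh

end GPoly

theorem mainTheorem1 {G : Type v} [Group G] [Finite G] (Oa Om : MorphismProperty (FinGSet.{u} G))
    [IsIndexingCategory Oa] [IsIndexingCategory Om] (hcompat : IsCompatible Oa Om) :
    (polySubgraph Oa Om).IsMultiplicative ∧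
      ∀ (S T : PolyCat.{u} G) (p : GPoly S.obj T.obj),
        polySubgraph Oa Om (PolyCat.mk p) ↔ Om p.g ∧ Oa p.h := by
  refine ⟨{ id_mem := fun S => ⟨GPoly.id S.obj, rfl, Om.id_mem _, Oa.id_mem _⟩
            comp_mem := ?_ }, fun S T p => ⟨?_, fun h => ⟨p, rfl, h⟩⟩⟩
  · rintro S T U _ _ ⟨p, rfl, hpg, hph⟩ ⟨q, rfl, hqg, hqh⟩
    -- Composition of classes is induced from `GPoly.comp`, so for chosen good representatives `p`
    -- and `q` the product class is the class of `GPoly.comp p q` by definition.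
    exact ⟨GPoly.comp p q, rfl, GPoly.comp_norm_mem p q hpg hqg,
      GPoly.comp_transfer_mem hcompat p q hph hqg hqh⟩
  -- The good representative `q` need not be `p`; equality of classes only yields an isomorphism
  -- from `q` to `p`, along which the two conditions are carried over.
  · rintro ⟨q, hq, h⟩
    obtain ⟨i⟩ := Quotient.exact hq
    exact i.norm_transfer_mem h
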